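/- For $m$ sampling vectors $\varphi=(\varphi_1,\dots,\varphi_m)$ in $\mathbb C^n$ consider the Poisson model: given $\varphi$ and a signal $x\in\mathbb C^n$, the observations $y_1,\dots,y_m$ are independent with $y_k\sim\mathrm{Poisson}(|\langle\varphi_k,x\rangle|^2)$. Let $\mathrm{dist}(z,x)=\min_{\theta\in[0,2\pi)}\|e^{i\theta}z-x\|_2$ and let $$R_{m,n}(\varphi)=\inf_{\widehat x}\ \sup_{z\in\mathbb C^n}\ \mathbb E\big[\mathrm{dist}(\widehat x(y),z)\,\big|\,\varphi\big]$$ be the minimax risk conditional on the sampling vectors, where the data $y$ follow the model with signal $z$ and the infimum is over all estimators, i.e. all maps $\widehat x$ from the observations $y\in\mathbb N^m$ to $\mathbb C^n$ (which may depend on $\varphi$). Let $\varphi_1,\dots,\varphi_m$ be i.i.d. $\mathcal{CN}(0,I_n)$. There are universal constants $L,C_1,C_2>0$ such that the following hold. (a) For every constant $L_1>0$: over all $n,m$ with $m\ge Ln$ and $\frac{m}{n^2}\le\frac{L_1}{\log^3 m}$, with probability tending to $1$ as $n,m\to\infty$, for every $x\in\mathbb C^n\setminus\{0\}$, $$R_{m,n}(\varphi)\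 \ge\ C_1\min\left\{\|x\|_2,\ \frac{\sqrt{n/m}}{1+\frac{\log^{3/4}m}{\sqrt{\|x\|_2}}\left(\frac mn\right)^{1/4}}\right\}.$$ (b) For every constant $L_2>0$ and every function $\rho(n,m)=o\!\left(\frac{\sqrt{n/m}}{\log^{3/2}m}\right)$ as $n,m\to\infty$: over all $n,m$ with $m\ge Ln$ and $\frac mn\le L_2\log m$, with probability tending to $1$ as $n,m\to\infty$, for every $x\in\mathbb C^n\setminus\{0\}$ with $\|x\|_2\le\rho(n,m)$, $$R_{m,n}(\varphi)\ \ge\ C_2\,\sqrt{\|x\|_2}\;\frac{(n/m)^{1/4}}{\log^{5/4}m}.$$ In both parts the convergence of the probability is uniform over the pairs $(n,m)$ allowed: for every $\varepsilon>0$ there is $N$ such that the bound fails with probability at most $\varepsilon$ whenever $n,m\ge N$ satisfy the stated conditions. -/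

import Mathlib

open MeasureTheory ProbabilityTheory Filter Asymptotics
open scoped NNReal ENNReal Topology

noncomputable section

/-- The standard complex Gaussian law `CN(0, 1)` on `ℂ`: the real and imaginary parts are
independent centred real Gaussians of variance `1 / 2`. -/
def complexGaussian : Measure ℂ :=
  ((gaussianReal 0 (1 / 2)).prod (gaussianReal 0 (1 / 2))).map
    (fun p : ℝ × ℝ => (p.1 : ℂ) + (p.2 : ℂ) * Complex.I)

instance instIsProbabilityMeasureComplexGaussian : IsProbabilityMeasure complexGaussian :=
  Measure.isProbabilityMeasure_map (by fun_prop)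

/-- The law `CN(0, I_n)` on `ℂⁿ`: independent `CN(0, 1)` coordinates. -/
def complexGaussianVec (n : ℕ) : Measure (EuclideanSpace ℂ (Fin n)) :=
  (Measure.pi (fun _ : Fin n => complexGaussian)).map (WithLp.toLp 2)

instance instIsProbabilityMeasureComplexGaussianVec (n : ℕ) :
    IsProbabilityMeasure (complexGaussianVec n) :=
  Measure.isProbabilityMeasure_map (by fun_prop)

/-- The joint law of `m` independent sampling vectors with law `CN(0, I_n)`. -/
def designLaw (m n : ℕ) : Measure (Fin m → EuclideanSpace ℂ (Fin n)) :=
  Measure.pi (fun _ : Fin m => complexGaussianVec n)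

instance instIsProbabilityMeasureDesignLaw (m n : ℕ) : IsProbabilityMeasure (designLaw m n) := by
  unfold designLaw; infer_instance

/-- The distance modulo a global phase,
`dist(z, x) = min_{θ ∈ [0, 2π)} ‖e^{iθ} z - x‖₂`. -/
def phaseDist {n : ℕ} (z x : EuclideanSpace ℂ (Fin n)) : ℝ :=
  ⨅ θ : Set.Ico (0 : ℝ) (2 * Real.pi), ‖Complex.exp (Complex.I * (θ : ℝ)) • z - x‖

/-- The Poisson model: given the sampling vectors `φ` and the signal `x`, the observations `y_k`
are independent with `y_k ∼ Poisson(|⟨φ_k, x⟩|²)`. -/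
def poissonObs {m n : ℕ} (φ : Fin m → EuclideanSpace ℂ (Fin n))
    (x : EuclideanSpace ℂ (Fin n)) : Measure (Fin m → ℕ) :=
  Measure.pi (fun k : Fin m => poissonMeasure (‖inner ℂ (φ k) x‖₊ ^ 2))

/-- The minimax risk `inf_{x̂} sup_{x ∈ ℂⁿ} E[dist(x̂, x) | φ]` of the Poisson model, conditionally
on the sampling vectors `φ`, as an element of `[0, ∞]`. An estimator maps the observed counts to
`ℂⁿ` (every map on the countable discrete space of counts is measurable). Since `φ` is fixed, the
estimator may depend on it in an arbitrary way. -/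
def poissonMinimaxRisk {m n : ℕ} (φ : Fin m → EuclideanSpace ℂ (Fin n)) : ℝ≥0∞ :=
  ⨅ xhat : (Fin m → ℕ) → EuclideanSpace ℂ (Fin n),
    ⨆ x : EuclideanSpace ℂ (Fin n),
      ∫⁻ y, ENNReal.ofReal (phaseDist (xhat y) x) ∂(poissonObs φ x)

end

/-! The minimax risk takes its supremum over all signals, so it does not depend on `x`, and both
parts follow from one bound: with high probability the risk is at least a constant times `√(n/m)`.
In (a) the right-hand side is at most this because the denominator is at least 1; in (b) because
`‖x‖ ≤ √(n/m)` eventually and `log m ≥ 1`. The bound is Assouad's method on the cube `{0, δ}ⁿ` with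
`δ` of order `1/√m`. Adjacent vertices differ in one coordinate, so the Hellinger affinity of their
Poisson laws is controlled by `δ² ∑ₖ |φₖⱼ|²` (`poissonObs_testing_error`). Averaging over vertices
gives one that every decoder gets wrong in order `n` coordinates (`exists_vertex_hamming_error`),
provided `δ² ∑ₖ ‖φₖ‖² ≤ n/2`. The global phase does no harm, since the coordinates are nonnegative.
Chebyshev's inequality bounds the energy `∑ₖ ‖φₖ‖²` by a multiple of `m n`. -/

/-! ### Two-point testing between Poisson laws. -/

/-- The Hellinger-type pointwise comparison of two Poisson laws with the Poisson law whose rate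
is the geometric mean of their rates. -/
lemma poissonMeasure_real_singleton_mul (a b : ℝ≥0) (k : ℕ) :
    (poissonMeasure (a ^ 2)).real {k} * (poissonMeasure (b ^ 2)).real {k} =
      (Real.exp (-((a : ℝ) - b) ^ 2 / 2) * (poissonMeasure (a * b)).real {k}) ^ 2 := by
  simp only [poissonMeasure_real_singleton, NNReal.coe_pow, NNReal.coe_mul]
  have h : Real.exp (-(a : ℝ) ^ 2) * Real.exp (-(b : ℝ) ^ 2) =
      (Real.exp (-((a : ℝ) - b) ^ 2 / 2) * Real.exp (-((a : ℝ) * b))) ^ 2 := by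
    rw [← Real.exp_add, ← Real.exp_add, ← Real.exp_nat_mul]
    congr 1
    push_cast
    ring
  calc _ = (Real.exp (-(a : ℝ) ^ 2) * Real.exp (-(b : ℝ) ^ 2)) *
        ((a : ℝ) ^ k * b ^ k / (k.factorial : ℝ)) ^ 2 := by ring
    _ = _ := by rw [h]; ring

lemma measureReal_pi_singleton {m : ℕ} (μ : Fin m → Measure ℕ) [∀ k, IsProbabilityMeasure (μ k)]
    (y : Fin m → ℕ) : (Measure.pi μ).real {y} = ∏ k, (μ k).real {y k} := by
  simp [measureReal_def, ENNReal.toReal_prod]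

/-- On a countable space an inequality between masses of points sums to one between measures. -/
lemma measureReal_le_combination {α : Type*} [Countable α] [MeasurableSpace α]
    [MeasurableSingletonClass α] (P Q R : Measure α) [IsFiniteMeasure P] [IsFiniteMeasure Q]
    [IsFiniteMeasure R] {a b c : ℝ} (ha : 0 ≤ a) (hb : 0 ≤ b) (hc : 0 ≤ c)
    (h : ∀ y, a * R.real {y} ≤ b * P.real {y} + c * Q.real {y}) (T : Set α) :
    a * R.real T ≤ b * P.real T + c * Q.real T := by
  have key : ENNReal.ofReal a • R ≤ ENNReal.ofReal b • P + ENNReal.ofReal c • Q := by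
    rw [Measure.le_iff]
    intro s hs
    rw [← Measure.tsum_indicator_apply_singleton _ s hs,
      ← Measure.tsum_indicator_apply_singleton _ s hs]
    refine ENNReal.tsum_le_tsum fun y => Set.indicator_le_indicator ?_
    have := ENNReal.ofReal_le_ofReal (h y)
    rw [ENNReal.ofReal_add (by positivity) (by positivity), ENNReal.ofReal_mul ha,
      ENNReal.ofReal_mul hb, ENNReal.ofReal_mul hc] at this
    simpa using this
  have hfin : ∀ (x : ℝ) (μ : Measure α) [IsFiniteMeasure μ],
      ENNReal.ofReal x * μ T ≠ ∞ := fun x μ _ => by finiteness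
  have h1 := key T
  simp only [Measure.add_apply, Measure.smul_apply, smul_eq_mul] at h1
  have h2 := ENNReal.toReal_mono (ENNReal.add_ne_top.2 ⟨hfin b P, hfin c Q⟩) h1
  rw [ENNReal.toReal_add (hfin b P) (hfin c Q)] at h2
  simpa [ENNReal.toReal_mul, ENNReal.toReal_ofReal, ha, hb, hc, measureReal_def] using h2

/-- Two laws with pointwise Hellinger affinity at least `A` times a probability law cannot be
tested with total error below `A ^ 2 / 2`. -/
lemma half_sq_le_testing_error {α : Type*} [Countable α] [MeasurableSpace α]
    [MeasurableSingletonClass α] (P Q R : Measure α) [IsProbabilityMeasure P]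
    [IsProbabilityMeasure Q] [IsProbabilityMeasure R] {A : ℝ} (hA : 0 < A)
    (h : ∀ y, P.real {y} * Q.real {y} = (A * R.real {y}) ^ 2) (T : Set α) :
    A ^ 2 / 2 ≤ P.real T + Q.real Tᶜ := by
  -- AM-GM with weights of product 1/4. The large weight `A⁻¹` will fall on the error probabilities,
  -- the small one on terms bounded by 1.
  have amgm : ∀ p q r : ℝ, 0 ≤ p → 0 ≤ q → 0 ≤ r → p * q = (A * r) ^ 2 →
      A * r ≤ A⁻¹ * p + A / 4 * q := by
    intro p q r hp hq hr hpq
    refine abs_le_of_sq_le_sq' ?_ (by positivity) |>.2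
    rw [← hpq]
    have : A⁻¹ * A = 1 := inv_mul_cancel₀ hA.ne'
    nlinarith [sq_nonneg (A⁻¹ * p - A / 4 * q)]
  have h1 := measureReal_le_combination P Q R hA.le (inv_nonneg.2 hA.le)
    (by positivity : 0 ≤ A / 4) (fun y => amgm _ _ _ (by positivity) (by positivity)
      (by positivity) (h y)) T
  have h2 := measureReal_le_combination Q P R hA.le (inv_nonneg.2 hA.le)
    (by positivity : 0 ≤ A / 4) (fun y => amgm _ _ _ (by positivity) (by positivity)
      (by positivity) (by rw [mul_comm]; exact h y)) Tᶜ
  have hT : MeasurableSet T := T.to_countable.measurableSet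
  rw [probReal_compl_eq_one_sub hT (μ := R), probReal_compl_eq_one_sub hT (μ := P)] at h2
  have hQ : Q.real T ≤ 1 := measureReal_le_one
  have hP : 0 ≤ P.real T := measureReal_nonneg
  set e := P.real T + Q.real Tᶜ with he
  -- Sum of the bounds on `T` and `Tᶜ`: the masses of `R` add to 1, and each small-weight term is at
  -- most `A / 4`.
  have h3 : A ≤ A⁻¹ * e + A / 2 := by
    rw [he]
    nlinarith
  have h4 : A / 2 ≤ A⁻¹ * e := by linarith
  calc A ^ 2 / 2 = A * (A / 2) := by ring
    _ ≤ A * (A⁻¹ * e) := by gcongr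
    _ = e := by field_simp

instance instIsProbabilityMeasurePoissonObs {m n : ℕ} (φ : Fin m → EuclideanSpace ℂ (Fin n))
    (x : EuclideanSpace ℂ (Fin n)) : IsProbabilityMeasure (poissonObs φ x) := by
  unfold poissonObs
  infer_instance

/-- Lower bound on the error of testing between two signals in the Poisson model. -/
lemma poissonObs_testing_error {m n : ℕ} (φ : Fin m → EuclideanSpace ℂ (Fin n))
    (x x' : EuclideanSpace ℂ (Fin n)) (T : Set (Fin m → ℕ)) :
    (1 - ∑ k, ‖inner ℂ (φ k) (x - x')‖ ^ 2) / 2 ≤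
      (poissonObs φ x).real T + (poissonObs φ x').real Tᶜ := by
  set a : Fin m → ℝ≥0 := fun k => ‖inner ℂ (φ k) x‖₊
  set b : Fin m → ℝ≥0 := fun k => ‖inner ℂ (φ k) x'‖₊
  set A : ℝ := ∏ k, Real.exp (-((a k : ℝ) - b k) ^ 2 / 2) with hA
  have hApos : 0 < A := Finset.prod_pos fun k _ => Real.exp_pos _
  have htest := half_sq_le_testing_error (poissonObs φ x) (poissonObs φ x')
    (Measure.pi fun k => poissonMeasure (a k * b k)) hApos (fun y => by
      unfold poissonObs
      rw [measureReal_pi_singleton, measureReal_pi_singleton, measureReal_pi_singleton, hA,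
        ← Finset.prod_mul_distrib, ← Finset.prod_mul_distrib, ← Finset.prod_pow]
      exact Finset.prod_congr rfl fun k _ => poissonMeasure_real_singleton_mul (a k) (b k) (y k)) T
  refine le_trans ?_ htest
  have hA2 : A ^ 2 = Real.exp (-∑ k, ((a k : ℝ) - b k) ^ 2) := by
    rw [hA, ← Real.exp_sum, ← Real.exp_nat_mul, Finset.mul_sum, ← Finset.sum_neg_distrib]
    congr 1
    refine Finset.sum_congr rfl fun k _ => ?_
    push_cast
    ring
  -- Reverse triangle inequality: dropping the phases only brings the two laws closer.
  have hsum : ∑ k, ((a k : ℝ) - b k) ^ 2 ≤ ∑ k, ‖inner ℂ (φ k) (x - x')‖ ^ 2 := by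
    refine Finset.sum_le_sum fun k _ => ?_
    rw [inner_sub_right, ← sq_abs]
    exact pow_le_pow_left₀ (abs_nonneg _) (abs_norm_sub_norm_le _ _) 2
  have := Real.add_one_le_exp (-∑ k, ((a k : ℝ) - b k) ^ 2)
  rw [hA2]
  linarith

/-! ### Geometry of the cube modulo phase. -/

/-- The signal equal to `δ` on the coordinates selected by `ε` and to `0` elsewhere. -/
noncomputable def cubeSignal {n : ℕ} (δ : ℝ) (ε : Fin n → Bool) : EuclideanSpace ℂ (Fin n) :=
  WithLp.toLp 2 fun j => if ε j then (δ : ℂ) else 0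

/-- The vertex of the cube adjacent to `ε` in direction `j`. -/
def flipAt {n : ℕ} (j : Fin n) (ε : Fin n → Bool) : Fin n → Bool :=
  Function.update ε j (!ε j)

lemma flipAt_involutive {n : ℕ} (j : Fin n) : Function.Involutive (flipAt j) := by
  intro ε
  simp [flipAt]

lemma norm_inner_cubeSignal_sub_flipAt {n : ℕ} {δ : ℝ} (hδ : 0 ≤ δ) (ε : Fin n → Bool)
    (j : Fin n) (v : EuclideanSpace ℂ (Fin n)) :
    ‖inner ℂ v (cubeSignal δ ε - cubeSignal δ (flipAt j ε))‖ = δ * ‖v j‖ := by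
  have h : cubeSignal δ ε - cubeSignal δ (flipAt j ε) =
      EuclideanSpace.single j (if ε j then (δ : ℂ) else -δ) := by
    ext i
    by_cases hij : i = j
    · subst hij
      cases hε : ε i <;> simp [cubeSignal, flipAt, hε]
    · simp [cubeSignal, flipAt, hij]
  rw [h, EuclideanSpace.inner_single_right]
  split_ifs <;> simp [abs_of_nonneg hδ]

lemma norm_cubeSignal_sub_sq {n : ℕ} (δ : ℝ) (ε ε' : Fin n → Bool) :
    ‖cubeSignal δ ε - cubeSignal δ ε'‖ ^ 2 = δ ^ 2 * ∑ j, if ε j ≠ ε' j then (1 : ℝ) else 0 := by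
  rw [EuclideanSpace.norm_sq_eq, Finset.mul_sum]
  refine Finset.sum_congr rfl fun j _ => ?_
  cases h : ε j <;> cases h' : ε' j <;> simp [cubeSignal, h, h']

/-- Coordinatewise: equal entries contribute 0 on the left, and if the entries differ one of them is
0, so the phase has no effect. -/
lemma norm_cubeSignal_sub_le {n : ℕ} {δ : ℝ} (ε ε' : Fin n → Bool) {c : ℂ}
    (hc : ‖c‖ = 1) :
    ‖cubeSignal δ ε - cubeSignal δ ε'‖ ≤ ‖c • cubeSignal δ ε - cubeSignal δ ε'‖ := by
  refine (sq_le_sq₀ (norm_nonneg _) (norm_nonneg _)).1 ?_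
  rw [EuclideanSpace.norm_sq_eq, EuclideanSpace.norm_sq_eq]
  refine Finset.sum_le_sum fun j _ => ?_
  cases h : ε j <;> cases h' : ε' j <;> simp [cubeSignal, h, h', hc]

/-- Signals with nonnegative coordinates cannot be brought closer by a global phase, so
`phaseDist` to them obeys a triangle inequality with the Euclidean norm. -/
lemma norm_cubeSignal_sub_le_phaseDist_add {n : ℕ} (δ : ℝ) (ε ε' : Fin n → Bool)
    (w : EuclideanSpace ℂ (Fin n)) :
    ‖cubeSignal δ ε - cubeSignal δ ε'‖ ≤
      phaseDist w (cubeSignal δ ε) + phaseDist w (cubeSignal δ ε') := by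
  have : Nonempty (Set.Ico (0 : ℝ) (2 * Real.pi)) := ⟨⟨0, by simp [Real.pi_pos]⟩⟩
  have key : ∀ a b : ℝ, ‖cubeSignal δ ε - cubeSignal δ ε'‖ ≤
      ‖Complex.exp (Complex.I * a) • w - cubeSignal δ ε‖ +
        ‖Complex.exp (Complex.I * b) • w - cubeSignal δ ε'‖ := by
    intro a b
    have hn : ∀ t : ℝ, ‖Complex.exp (Complex.I * t)‖ = 1 := fun t => by
      rw [mul_comm]; exact Complex.norm_exp_ofReal_mul_I t
    -- The relative phase, which carries the first rotated copy of `w` to the second.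
    set c := Complex.exp (Complex.I * ((b - a : ℝ) : ℂ)) with hc
    have hca : Complex.exp (Complex.I * b) = c * Complex.exp (Complex.I * a) := by
      rw [hc, ← Complex.exp_add]
      congr 1
      push_cast
      ring
    calc _ ≤ ‖c • cubeSignal δ ε - cubeSignal δ ε'‖ := norm_cubeSignal_sub_le ε ε' (hn _)
      _ = ‖-(c • (Complex.exp (Complex.I * a) • w - cubeSignal δ ε)) +
          (Complex.exp (Complex.I * b) • w - cubeSignal δ ε')‖ := by
        rw [hca, smul_sub, smul_smul]
        congr 1
        abel
      _ ≤ _ := by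
        refine (norm_add_le _ _).trans ?_
        rw [norm_neg, norm_smul, hn, one_mul]
  rw [← sub_le_iff_le_add]
  refine le_ciInf fun a => ?_
  rw [sub_le_comm]
  refine le_ciInf fun b => ?_
  rw [sub_le_iff_le_add']
  exact key a b

/-- The vertex of the cube whose signal is nearest to `w`. -/
noncomputable def nearestVertex {n : ℕ} (δ : ℝ) (w : EuclideanSpace ℂ (Fin n)) : Fin n → Bool :=
  (Finite.exists_min fun ε => phaseDist w (cubeSignal δ ε)).choose

lemma phaseDist_nearestVertex_le {n : ℕ} (δ : ℝ) (w : EuclideanSpace ℂ (Fin n))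
    (ε : Fin n → Bool) :
    phaseDist w (cubeSignal δ (nearestVertex δ w)) ≤ phaseDist w (cubeSignal δ ε) :=
  (Finite.exists_min fun ε => phaseDist w (cubeSignal δ ε)).choose_spec ε

/-- Minimality of the nearest vertex and the triangle inequality give twice the distance as an upper
bound for `δ√H`. Since `H ≤ n`, `√H ≥ H/√n`, which makes the loss additive over coordinates. -/
lemma hamming_le_phaseDist {n : ℕ} (hn : 0 < n) (δ : ℝ)
    (w : EuclideanSpace ℂ (Fin n)) (ε : Fin n → Bool) :
    δ / (2 * √n) * ∑ j, (if nearestVertex δ w j ≠ ε j then (1 : ℝ) else 0) ≤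
      phaseDist w (cubeSignal δ ε) := by
  set H : ℝ := ∑ j, (if nearestVertex δ w j ≠ ε j then (1 : ℝ) else 0) with hH
  have hH0 : 0 ≤ H := Finset.sum_nonneg fun j _ => by split_ifs <;> norm_num
  have hHn : H ≤ n := by
    calc H ≤ ∑ _j : Fin n, (1 : ℝ) := Finset.sum_le_sum fun j _ => by split_ifs <;> norm_num
      _ = n := by simp
  have hn' : (0 : ℝ) < n := by exact_mod_cast hn
  have h1 := norm_cubeSignal_sub_le_phaseDist_add δ (nearestVertex δ w) ε w
  have h2 := phaseDist_nearestVertex_le δ w ε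
  have h3 : δ / √n * H ≤ ‖cubeSignal δ (nearestVertex δ w) - cubeSignal δ ε‖ := by
    refine abs_le_of_sq_le_sq' ?_ (norm_nonneg _) |>.2
    rw [norm_cubeSignal_sub_sq, ← hH, mul_pow, div_pow, Real.sq_sqrt hn'.le, div_mul_eq_mul_div,
      div_le_iff₀ hn', mul_assoc]
    gcongr
    nlinarith
  have h4 : δ / (2 * √n) * H = δ / √n * H / 2 := by
    field_simp
  linarith

/-! ### Assouad's method and the conditional risk bound. -/

/-- Assouad's bound over the cube: some vertex is decoded with many wrong coordinates. -/
lemma exists_vertex_hamming_error {m n : ℕ} (φ : Fin m → EuclideanSpace ℂ (Fin n)) {δ : ℝ}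
    (hδ : 0 ≤ δ) (g : (Fin m → ℕ) → Fin n → Bool) :
    ∃ ε : Fin n → Bool, (n - δ ^ 2 * ∑ k, ‖φ k‖ ^ 2) / 4 ≤
      ∑ j, (poissonObs φ (cubeSignal δ ε)).real {y | g y j ≠ ε j} := by
  have hpair : ∀ (ε : Fin n → Bool) (j : Fin n), (1 - δ ^ 2 * ∑ k, ‖φ k j‖ ^ 2) / 2 ≤
      (poissonObs φ (cubeSignal δ ε)).real {y | g y j ≠ ε j} +
        (poissonObs φ (cubeSignal δ (flipAt j ε))).real {y | g y j ≠ flipAt j ε j} := by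
    intro ε j
    have h := poissonObs_testing_error φ (cubeSignal δ ε) (cubeSignal δ (flipAt j ε))
      {y | g y j ≠ ε j}
    have hc : {y | g y j ≠ ε j}ᶜ = {y | g y j ≠ flipAt j ε j} := by
      ext y
      cases h1 : g y j <;> cases h2 : ε j <;> simp [flipAt, h1, h2]
    simp only [norm_inner_cubeSignal_sub_flipAt hδ, mul_pow, ← Finset.mul_sum, hc] at h
    exact h
  have hsum : ∀ j : Fin n, ∑ _ε : Fin n → Bool, (1 - δ ^ 2 * ∑ k, ‖φ k j‖ ^ 2) / 4 ≤
      ∑ ε : Fin n → Bool, (poissonObs φ (cubeSignal δ ε)).real {y | g y j ≠ ε j} := by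
    intro j
    have h1 := Finset.sum_le_sum fun ε (_ : ε ∈ Finset.univ) => hpair ε j
    -- Flipping permutes the vertices, so both errors of a pair have the same total over the cube;
    -- this halves `1/2` to `1/4`.
    have h2 := (flipAt_involutive j).bijective.sum_comp
      fun ε => (poissonObs φ (cubeSignal δ ε)).real {y | g y j ≠ ε j}
    rw [Finset.sum_add_distrib, h2] at h1
    rw [Finset.sum_const] at h1 ⊢
    simp only [nsmul_eq_mul] at h1 ⊢
    linarith
  have htot : ∀ ε : Fin n → Bool, (n - δ ^ 2 * ∑ k, ‖φ k‖ ^ 2) / 4 =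
      ∑ j, (1 - δ ^ 2 * ∑ k, ‖φ k j‖ ^ 2) / 4 := by
    intro _
    rw [← Finset.sum_div, Finset.sum_sub_distrib, ← Finset.mul_sum, Finset.sum_comm]
    simp [EuclideanSpace.norm_sq_eq]
  obtain ⟨ε, -, hε⟩ := Finset.exists_le_of_sum_le (s := (Finset.univ : Finset (Fin n → Bool)))
    (f := fun _ => (n - δ ^ 2 * ∑ k, ‖φ k‖ ^ 2) / 4)
    (g := fun ε => ∑ j, (poissonObs φ (cubeSignal δ ε)).real {y | g y j ≠ ε j}) Finset.univ_nonempty (by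
      rw [Finset.sum_congr rfl fun ε _ => htot ε, Finset.sum_comm]
      refine (Finset.sum_le_sum fun j _ => hsum j).trans_eq ?_
      rw [Finset.sum_comm])
  exact ⟨ε, hε⟩

/-- Any estimator becomes a decoder by rounding to the nearest vertex, and its loss dominates the
scaled Hamming error, whose mean is the sum of the coordinate error probabilities. -/
lemma le_poissonMinimaxRisk {m n : ℕ} (hn : 0 < n) (φ : Fin m → EuclideanSpace ℂ (Fin n)) {δ : ℝ}
    (hδ : 0 ≤ δ) :
    ENNReal.ofReal (δ / (2 * √n) * ((n - δ ^ 2 * ∑ k, ‖φ k‖ ^ 2) / 4)) ≤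
      poissonMinimaxRisk φ := by
  refine le_iInf fun xhat => ?_
  obtain ⟨ε, hε⟩ := exists_vertex_hamming_error φ hδ fun y => nearestVertex δ (xhat y)
  refine le_trans ?_ (le_iSup _ (cubeSignal δ ε))
  set P := poissonObs φ (cubeSignal δ ε)
  set T : Fin n → Set (Fin m → ℕ) := fun j => {y | nearestVertex δ (xhat y) j ≠ ε j}
  have hT : ∀ j, MeasurableSet (T j) := fun j => (T j).to_countable.measurableSet
  have hint : ∀ j, Integrable ((T j).indicator fun _ => (1 : ℝ)) P := fun j =>
    (integrable_const 1).indicator (hT j)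
  have hI : ∫ y, δ / (2 * √n) * ∑ j, (T j).indicator (fun _ => (1 : ℝ)) y ∂P =
      δ / (2 * √n) * ∑ j, P.real (T j) := by
    rw [integral_const_mul, integral_finsetSum _ fun j _ => hint j]
    congr 1
    exact Finset.sum_congr rfl fun j _ => by rw [integral_indicator_const _ (hT j)]; simp
  calc _ ≤ ENNReal.ofReal (∫ y, δ / (2 * √n) * ∑ j, (T j).indicator (fun _ => (1 : ℝ)) y ∂P) := by
        rw [hI]
        refine ENNReal.ofReal_le_ofReal ?_
        gcongr
    _ = ∫⁻ y, ENNReal.ofReal (δ / (2 * √n) * ∑ j, (T j).indicator (fun _ => (1 : ℝ)) y) ∂P := by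
        refine ofReal_integral_eq_lintegral_ofReal
          ((integrable_finsetSum _ fun j _ => hint j).const_mul _) (ae_of_all _ fun y => ?_)
        refine mul_nonneg (by positivity) (Finset.sum_nonneg fun j _ => ?_)
        exact Set.indicator_nonneg (fun _ _ => zero_le_one) _
    _ ≤ _ := by
        refine lintegral_mono fun y => ENNReal.ofReal_le_ofReal ?_
        refine le_trans (le_of_eq ?_) (hamming_le_phaseDist hn δ (xhat y) ε)
        simp [T, Set.indicator_apply]

/-! ### Energy of the Gaussian design. -/

lemma memLp_norm_sq_complexGaussian : MemLp (fun z : ℂ => ‖z‖ ^ 2) 2 complexGaussian := by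
  have hsq : MemLp (fun x : ℝ => x ^ 2) 2 (gaussianReal 0 (1 / 2)) := by
    have h := (memLp_id_gaussianReal' (μ := 0) (v := 1 / 2) 4 (by norm_num)).norm_rpow_div 2
    have e : (4 : ℝ≥0∞) / 2 = 2 := by
      
      rw [show (4 : ℝ≥0∞) = 2 * 2 by norm_num]
      exact ENNReal.mul_div_cancel_right (by norm_num) (by norm_num)
    rw [e] at h
    simpa using h
  unfold complexGaussian
  rw [memLp_map_measure_iff (by fun_prop) (by fun_prop)]
  have h1 := (hsq.comp_fst (gaussianReal 0 (1 / 2))).add (hsq.comp_snd (gaussianReal 0 (1 / 2)))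
  convert h1 using 1
  ext p
  simp only [Function.comp_apply, Pi.add_apply, ← Complex.normSq_eq_norm_sq,
    Complex.normSq_add_mul_I]

/-- The second absolute moment of a coordinate of a sampling vector. -/
noncomputable def complexGaussianPower : ℝ := ∫ z, ‖z‖ ^ 2 ∂complexGaussian

/-- The variance of the squared modulus of a coordinate of a sampling vector. -/
noncomputable def complexGaussianPowerVariance : ℝ := Var[fun z => ‖z‖ ^ 2; complexGaussian]

lemma complexGaussianPower_nonneg : 0 ≤ complexGaussianPower :=
  integral_nonneg fun _ => by positivity

section SumOverProduct

variable {ι Ω : Type*} [Fintype ι] [MeasurableSpace Ω] (μ : Measure Ω) [IsProbabilityMeasure μ]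
  {f : Ω → ℝ}

lemma memLp_sum_eval_pi (hf : MemLp f 2 μ) :
    MemLp (fun ω : ι → Ω => ∑ i, f (ω i)) 2 (Measure.pi fun _ => μ) :=
  memLp_finsetSum _ fun i _ => hf.comp_measurePreserving (measurePreserving_eval (fun _ => μ) i)

lemma integral_sum_eval_pi (hf : MemLp f 2 μ) :
    ∫ ω : ι → Ω, ∑ i, f (ω i) ∂(Measure.pi fun _ => μ) = Fintype.card ι * ∫ x, f x ∂μ := by
  rw [integral_finsetSum]
  · simp [integral_comp_eval (μ := fun _ : ι => μ) hf.1]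
  · intro i _
    exact (hf.comp_measurePreserving (measurePreserving_eval (fun _ => μ) i)).integrable
      (by norm_num)

lemma variance_sum_eval_pi (hf : MemLp f 2 μ) :
    Var[fun ω : ι → Ω => ∑ i, f (ω i); Measure.pi fun _ => μ] = Fintype.card ι * Var[f; μ] := by
  have h := variance_sum_pi (μ := fun _ : ι => μ) (X := fun _ => f) fun _ => hf
  have e : (∑ i : ι, fun ω : ι → Ω => f (ω i)) = fun ω => ∑ i, f (ω i) := by
    ext; simp
  rw [e] at h
  simpa using h

end SumOverProduct

lemma norm_sq_comp_toLp (n : ℕ) :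
    (fun v : EuclideanSpace ℂ (Fin n) => ‖v‖ ^ 2) ∘ WithLp.toLp 2 =
      fun v : Fin n → ℂ => ∑ j, ‖v j‖ ^ 2 := by
  ext v
  simp [EuclideanSpace.norm_sq_eq]

lemma memLp_norm_sq_complexGaussianVec (n : ℕ) :
    MemLp (fun v : EuclideanSpace ℂ (Fin n) => ‖v‖ ^ 2) 2 (complexGaussianVec n) := by
  unfold complexGaussianVec
  rw [memLp_map_measure_iff (by fun_prop) (by fun_prop), norm_sq_comp_toLp]
  exact memLp_sum_eval_pi _ memLp_norm_sq_complexGaussian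

lemma integral_norm_sq_complexGaussianVec (n : ℕ) :
    ∫ v, ‖v‖ ^ 2 ∂complexGaussianVec n = n * complexGaussianPower := by
  unfold complexGaussianVec
  rw [integral_map (by fun_prop) (by fun_prop)]
  have h := integral_sum_eval_pi (ι := Fin n) complexGaussian memLp_norm_sq_complexGaussian
  simpa [EuclideanSpace.norm_sq_eq, complexGaussianPower] using h

lemma variance_norm_sq_complexGaussianVec (n : ℕ) :
    Var[fun v => ‖v‖ ^ 2; complexGaussianVec n] = n * complexGaussianPowerVariance := by
  unfold complexGaussianVec
  rw [variance_map (by fun_prop) (by fun_prop), norm_sq_comp_toLp]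
  simpa [complexGaussianPowerVariance] using
    variance_sum_eval_pi (ι := Fin n) complexGaussian memLp_norm_sq_complexGaussian

/-- The total energy of the design rarely exceeds its mean by more than `m n`. -/
lemma designLaw_energy_le {m n : ℕ} (hm : 0 < m) (hn : 0 < n) :
    designLaw m n {φ | (m : ℝ) * n * (complexGaussianPower + 1) ≤ ∑ k, ‖φ k‖ ^ 2} ≤
      ENNReal.ofReal (complexGaussianPowerVariance / (m * n)) := by
  have hm' : (0 : ℝ) < m := by exact_mod_cast hm
  have hn' : (0 : ℝ) < n := by exact_mod_cast hn
  have hL := memLp_norm_sq_complexGaussianVec n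
  have hC := meas_ge_le_variance_div_sq (μ := designLaw m n)
    (X := fun φ => ∑ k, ‖φ k‖ ^ 2) (memLp_sum_eval_pi _ hL) (c := m * n) (by positivity)
  have hE : ∫ φ, ∑ k, ‖φ k‖ ^ 2 ∂designLaw m n = m * (n * complexGaussianPower) := by
    have := integral_sum_eval_pi (ι := Fin m) _ hL
    rwa [integral_norm_sq_complexGaussianVec, Fintype.card_fin] at this
  have hV : Var[fun φ => ∑ k, ‖φ k‖ ^ 2; designLaw m n] =
      m * (n * complexGaussianPowerVariance) := by
    have := variance_sum_eval_pi (ι := Fin m) _ hL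
    rwa [variance_norm_sq_complexGaussianVec, Fintype.card_fin] at this
  have hrw : (m : ℝ) * (n * complexGaussianPowerVariance) / (m * n) ^ 2 =
      complexGaussianPowerVariance / (m * n) := by
    field_simp
  rw [hE, hV, hrw] at hC
  refine le_trans (measure_mono fun φ hφ => ?_) hC
  rw [Set.mem_ofPred_eq] at hφ ⊢
  refine le_trans ?_ (le_abs_self _)
  linarith

/-! ### The `√(n/m)` bound and the theorem. -/

/-- The universal constant of the minimax lower bound. -/
noncomputable def riskConstant : ℝ := 1 / (16 * √(2 * (complexGaussianPower + 1)))

lemma riskConstant_pos : 0 < riskConstant := by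
  have := complexGaussianPower_nonneg
  unfold riskConstant
  positivity

lemma sqrt_le_poissonMinimaxRisk {m n : ℕ} (hm : 0 < m) (hn : 0 < n)
    {φ : Fin m → EuclideanSpace ℂ (Fin n)}
    (hφ : ∑ k, ‖φ k‖ ^ 2 < (m : ℝ) * n * (complexGaussianPower + 1)) :
    ENNReal.ofReal (riskConstant * √((n : ℝ) / m)) ≤ poissonMinimaxRisk φ := by
  have hm' : (0 : ℝ) < m := by exact_mod_cast hm
  have hn' : (0 : ℝ) < n := by exact_mod_cast hn
  have hκ : 0 < complexGaussianPower + 1 := by linarith [complexGaussianPower_nonneg]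
  set κ := complexGaussianPower + 1 with hκdef
  -- Chosen so that `δ² m n κ = n/2`; the Assouad factor is then at least `n/8`.
  set δ : ℝ := 1 / (√(2 * κ) * √m) with hδ
  have hδ2 : δ ^ 2 = 1 / (2 * κ * m) := by
    rw [hδ, div_pow, mul_pow, Real.sq_sqrt (by positivity), Real.sq_sqrt hm'.le, one_pow]
  refine le_trans (ENNReal.ofReal_le_ofReal ?_)
    (le_poissonMinimaxRisk hn φ (by positivity : 0 ≤ δ))
  have h1 : δ ^ 2 * ∑ k, ‖φ k‖ ^ 2 ≤ n / 2 := by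
    calc _ ≤ δ ^ 2 * (m * n * κ) := by gcongr
      _ = n / 2 := by rw [hδ2]; field_simp
  calc riskConstant * √((n : ℝ) / m) = δ / (2 * √n) * ((n : ℝ) / 8) := by
        rw [Real.sqrt_div hn'.le, riskConstant, ← hκdef, hδ]
        have : (n : ℝ) = √n * √n := (Real.mul_self_sqrt hn'.le).symm
        field_simp
        rw [Real.sq_sqrt hn'.le]
        ring
    _ ≤ _ := by
        refine mul_le_mul_of_nonneg_left ?_ (by positivity)
        linarith

lemma exists_forall_designLaw_risk_lt_le {ε : ℝ} (hε : 0 < ε) :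
    ∃ N : ℕ, ∀ n m : ℕ, N ≤ n → N ≤ m →
      designLaw m n {φ | ¬ ENNReal.ofReal (riskConstant * √((n : ℝ) / m)) ≤
        poissonMinimaxRisk φ} ≤ ENNReal.ofReal ε := by
  obtain ⟨N, hN⟩ := exists_nat_gt (complexGaussianPowerVariance / ε)
  refine ⟨N + 1, fun n m hn hm => ?_⟩
  have hm0 : 0 < m := by omega
  have hn0 : 0 < n := by omega
  refine le_trans (measure_mono fun φ hφ => ?_) ((designLaw_energy_le hm0 hn0).trans
    (ENNReal.ofReal_le_ofReal ?_))
  · rw [Set.mem_ofPred_eq] at hφ ⊢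
    by_contra hlt
    exact hφ (sqrt_le_poissonMinimaxRisk hm0 hn0 (not_le.1 hlt))
  · have hn1 : (1 : ℝ) ≤ n := by exact_mod_cast hn0
    have hm1 : (N : ℝ) ≤ m := by exact_mod_cast (by omega : N ≤ m)
    have hm' : (0 : ℝ) < m := by exact_mod_cast hm0
    rw [div_le_iff₀ (by positivity)]
    rw [div_lt_iff₀ hε] at hN
    have : (N : ℝ) ≤ m * n := hm1.trans (le_mul_of_one_le_right hm'.le hn1)
    nlinarith

/-- "With probability approaching 1" is expressed by saying that the (outer) probability that the
bound fails is at most `ε` for all large `n, m`, for every `ε > 0`. -/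
theorem theorem3 :
    ∃ L C₁ C₂ : ℝ, 0 < L ∧ 0 < C₁ ∧ 0 < C₂ ∧
      -- part (a)
      (∀ L₁ : ℝ, 0 < L₁ → ∀ ε : ℝ, 0 < ε → ∃ N : ℕ, ∀ n m : ℕ, N ≤ n → N ≤ m →
        L * (n : ℝ) ≤ (m : ℝ) →
        (m : ℝ) / (n : ℝ) ^ 2 ≤ L₁ / Real.log (m : ℝ) ^ 3 →
        designLaw m n {φ | ¬ ∀ x : EuclideanSpace ℂ (Fin n), x ≠ 0 →
          ENNReal.ofReal (C₁ * min ‖x‖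
            (Real.sqrt ((n : ℝ) / (m : ℝ)) /
              (1 + Real.log (m : ℝ) ^ (3 / 4 : ℝ) / Real.sqrt ‖x‖ *
                ((m : ℝ) / (n : ℝ)) ^ (1 / 4 : ℝ))))
            ≤ poissonMinimaxRisk φ} ≤ ENNReal.ofReal ε) ∧
      -- part (b)
      (∀ L₂ : ℝ, 0 < L₂ → ∀ ρ : ℕ × ℕ → ℝ,
        ρ =o[atTop] (fun p : ℕ × ℕ =>
          Real.sqrt ((p.1 : ℝ) / (p.2 : ℝ)) / Real.log (p.2 : ℝ) ^ (3 / 2 : ℝ)) →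
        ∀ ε : ℝ, 0 < ε → ∃ N : ℕ, ∀ n m : ℕ, N ≤ n → N ≤ m →
        L * (n : ℝ) ≤ (m : ℝ) →
        (m : ℝ) / (n : ℝ) ≤ L₂ * Real.log (m : ℝ) →
        designLaw m n {φ | ¬ ∀ x : EuclideanSpace ℂ (Fin n), x ≠ 0 → ‖x‖ ≤ ρ (n, m) →
          ENNReal.ofReal (C₂ * (Real.sqrt ‖x‖ *
            (((n : ℝ) / (m : ℝ)) ^ (1 / 4 : ℝ) / Real.log (m : ℝ) ^ (5 / 4 : ℝ))))
            ≤ poissonMinimaxRisk φ} ≤ ENNReal.ofReal ε) := by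
  refine ⟨1, riskConstant, riskConstant, one_pos, riskConstant_pos, riskConstant_pos, ?_, ?_⟩
  · intro L₁ _ ε hε
    obtain ⟨N, hN⟩ := exists_forall_designLaw_risk_lt_le hε
    refine ⟨N, fun n m hn hm _ _ => le_trans (measure_mono ?_) (hN n m hn hm)⟩
    intro φ hφ hrisk
    refine hφ fun x _ => le_trans (ENNReal.ofReal_le_ofReal ?_) hrisk
    have hlog : 0 ≤ Real.log (m : ℝ) := Real.log_natCast_nonneg m
    refine mul_le_mul_of_nonneg_left ((min_le_right _ _).trans ?_) riskConstant_pos.le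
    refine div_le_self (Real.sqrt_nonneg _) (le_add_of_nonneg_right ?_)
    positivity
  · intro L₂ _ ρ hρ ε hε
    obtain ⟨N, hN⟩ := exists_forall_designLaw_risk_lt_le hε
    obtain ⟨⟨N₁, N₂⟩, hN'⟩ := eventually_atTop.1 (hρ.bound one_pos)
    -- The 3 exceeds `e`, so that `log m ≥ 1`.
    refine ⟨max (max N 3) (max N₁ N₂), fun n m hn hm _ _ => ?_⟩
    simp only [max_le_iff] at hn hm
    refine le_trans (measure_mono ?_) (hN n m hn.1.1 hm.1.1)
    intro φ hφ hrisk
    refine hφ fun x _ hx => le_trans (ENNReal.ofReal_le_ofReal ?_) hrisk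
    have hlog : 1 ≤ Real.log (m : ℝ) := by
      rw [Real.le_log_iff_exp_le (by exact_mod_cast (by omega : 0 < m))]
      have h3 : (3 : ℝ) ≤ m := by exact_mod_cast hm.1.2
      linarith [Real.exp_one_lt_d9]
    have hlog0 : 0 ≤ Real.log (m : ℝ) := zero_le_one.trans hlog
    have hxs : ‖x‖ ≤ √((n : ℝ) / m) := by
      have hb := hN' (n, m) ⟨hn.2.1, hm.2.2⟩
      rw [one_mul, Real.norm_of_nonneg
        (div_nonneg (Real.sqrt_nonneg _) (Real.rpow_nonneg hlog0 _))] at hb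
      calc ‖x‖ ≤ ρ (n, m) := hx
        _ ≤ ‖ρ (n, m)‖ := Real.le_norm_self _
        _ ≤ _ := hb
        _ ≤ _ := div_le_self (Real.sqrt_nonneg _) (Real.one_le_rpow hlog (by norm_num))
    have hq : √(√((n : ℝ) / m)) = ((n : ℝ) / m) ^ (1 / 4 : ℝ) := by
      rw [Real.sqrt_eq_rpow, Real.sqrt_eq_rpow, ← Real.rpow_mul (by positivity)]
      norm_num
    refine mul_le_mul_of_nonneg_left ?_ riskConstant_pos.le
    -- Each of the two factors is at most `(n/m)^(1/4)`.
    calc √‖x‖ * (((n : ℝ) / m) ^ (1 / 4 : ℝ) / Real.log (m : ℝ) ^ (5 / 4 : ℝ))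
        ≤ √(√((n : ℝ) / m)) * √(√((n : ℝ) / m)) := by
          gcongr
          rw [hq]
          exact div_le_self (by positivity) (Real.one_le_rpow hlog (by norm_num))
      _ = √((n : ℝ) / m) := Real.mul_self_sqrt (Real.sqrt_nonneg _)
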